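/- Let $\ell_1$ be the real Banach lattice of absolutely summable sequences $(x_i)_{i\ge 0}$ with unit vectors $(f_i)_{i\ge0}$, and let $F$ be the linear span of the $f_i$. Let $\mathbf d=(a_1,b_1,a_2,b_2,\dots)$ be a strictly increasing sequence of positive integers, and put $a_0=1$, $b_0=0$ and $v_n=n(a_n+b_n)$ for $n\ge 0$ (so $v_0=0$). Consider sequences $(e_i)_{i\ge0}$ in $F$ such that (with $0^0=1$) 0) $f_0=e_0$; A) if $0<r\le n$ and $ra_n\le i\le v_{n-r}+ra_n$, then $f_i=(n^{ra_n}e_i-e_{i-ra_n})(n-r)^{i-ra_n}a_{n-r}$; B) if $0<r<n$ and $ra_n+v_{n-r}<i<(r+1)a_n$, then $f_i=n^i2^{((r+1/2)a_n-i)/\sqrt{a_n}}e_i$; and if $n\ge1$ and $v_{n-1}<i<a_n$, then $f_i=n^i2^{(a_n/2-i)/\sqrt{a_n}}e_i$; C) if $0<r\le n$ and $r(a_n+b_n)\le i\le na_n+rb_n$, then $f_i=n^ie_i-b_nn^{i-b_n}e_{i-b_n}$; D) if $0\le r<n$ and $na_n+rb_n<i<(r+1)(a_n+b_n)$, then $f_i=n^i2^{((r+1/2)b_n-i)/\sqrt{b_n}}e_i$.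 **Lemma.** Let $\mathbf d$ increase sufficiently rapidly; that is, there are functions $G,H$ with values in the nonnegative integers such that the following holds for every $\mathbf d$ as above with $a_n\ge G(n,a_0,b_0,\dots,a_{n-1},b_{n-1})$ and $b_n\ge H(n,a_0,b_0,\dots,a_{n-1},b_{n-1},a_n)$ for all $n\ge1$. There is exactly one sequence $(e_i)$ in $F$ satisfying 0) and A)–D), and exactly one bounded operator $T$ on $\ell_1$ with $Te_i=e_{i+1}$ for all $i\ge0$ (C. J. Read's operator). The negative part $T^-$, i.e. the least upper bound of $-T$ and $0$ in the ordered space of bounded operators on $\ell_1$, exists and is nuclear, hence compact. Moreover, let $t^-_{kj}=(T^-f_j)_k$ be the entries of its matrix, and let $T^-_{(k)}=(t^-_{kj})_{j\ge0}$ be the rows. The only nonzero entries are $$t^-_{1+v_{n-r},\,v_{n-r}+ra_n}=(n-r+1)^{-1-v_{n-r}}\,2^{(1+v_{n-r}-a_{n-r+1}/2)/\sqrt{a_{n-r+1}}}\,a_{n-r}(n-r)^{v_{n-r}}$$ and $$t^-_{na_n+(r-1)b_n+1,\,na_n+rb_n}=b_nn^{-1}2^{(1+na_n-b_n/2)/\sqrt{b_n}},$$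 for $0<r\le n$; and the nuclear norm satisfies $\nu(T^-)\le\sum_{k=0}^\infty\|T^-_{(k)}\|_\infty<2$. Here an operator $S$ on $\ell_1$ is nuclear if $S=\sum_{i=0}^\infty x_i^*\otimes y_i$ with $x_i^*\in\ell_1^*$, $y_i\in\ell_1$ and $\sum_i\|x_i^*\|\|y_i\|<\infty$, where $(x^*\otimes y)(x)=x^*(x)y$, and $\nu(S)$ is the infimum of $\sum_i\|x_i^*\|\|y_i\|$ over all such representations. -/

import Mathlib

namespace Read

noncomputable section

/-- The real Banach space `ℓ₁`, with coordinates indexed by `0, 1, 2, …`. -/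
abbrev Ell1 : Type := lp (fun _ : ℕ => ℝ) 1

/-- The standard unit vectors `f₀, f₁, f₂, …` of `ℓ₁`. -/
def f (i : ℕ) : Ell1 := lp.single 1 i (1 : ℝ)

/-- The linear subspace `F` of `ℓ₁` spanned by the unit vectors. -/
def F : Submodule ℝ Ell1 := Submodule.span ℝ (Set.range f)

/-- The pair `(a, b)` encodes a strictly increasing sequence `(a₁, b₁, a₂, b₂, …)` of positive
integers, together with the convention `a₀ = 1` (and `b₀ = 0`, a value that is never used). -/
structure IsData (a b : ℕ → ℕ) : Prop where
  a_zero : a 0 = 1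
  b_zero : b 0 = 0
  a_one_pos : 0 < a 1
  a_lt_b : ∀ n, 1 ≤ n → a n < b n
  b_lt_a : ∀ n, 1 ≤ n → b n < a (n + 1)

/-- The growth condition given by `G` and `H`: for all `n ≥ 1`,
`aₙ ≥ G(n, a₀, b₀, …, aₙ₋₁, bₙ₋₁)` and `bₙ ≥ H(n, a₀, b₀, …, aₙ₋₁, bₙ₋₁, aₙ)`. -/
def Grows (G : (n : ℕ) → (Fin n → ℕ) → (Fin n → ℕ) → ℕ)
    (H : (n : ℕ) → (Fin n → ℕ) → (Fin n → ℕ) → ℕ → ℕ) (a b : ℕ → ℕ) : Prop :=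
  ∀ n, 1 ≤ n →
    G n (fun i => a i) (fun i => b i) ≤ a n ∧
    H n (fun i => a i) (fun i => b i) (a n) ≤ b n

/-- `v₀ = 0` and `vₙ = n (aₙ + bₙ)`. -/
def v (a b : ℕ → ℕ) (n : ℕ) : ℕ := n * (a n + b n)

/-- The relations that define the sequence `(eᵢ)` in `F`. -/
structure IsReadSequence (a b : ℕ → ℕ) (e : ℕ → Ell1) : Prop where
  mem_F : ∀ i, e i ∈ F
  zero : f 0 = e 0
  relA : ∀ r n i : ℕ, 0 < r → r ≤ n → r * a n ≤ i → i ≤ v a b (n - r) + r * a n →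
    f i = (((n : ℝ) - r) ^ (i - r * a n) * (a (n - r) : ℝ)) •
      ((n : ℝ) ^ (r * a n) • e i - e (i - r * a n))
  relB : ∀ r n i : ℕ, 0 < r → r < n → r * a n + v a b (n - r) < i → i < (r + 1) * a n →
    f i = ((n : ℝ) ^ i *
      (2 : ℝ) ^ ((((r : ℝ) + 1 / 2) * (a n : ℝ) - (i : ℝ)) / √(a n : ℝ))) • e i
  relB' : ∀ n i : ℕ, 1 ≤ n → v a b (n - 1) < i → i < a n →
    f i = ((n : ℝ) ^ i *
      (2 : ℝ) ^ (((1 / 2) * (a n : ℝ) - (i : ℝ)) / √(a n : ℝ))) • e i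
  relC : ∀ r n i : ℕ, 0 < r → r ≤ n → r * (a n + b n) ≤ i → i ≤ n * a n + r * b n →
    f i = (n : ℝ) ^ i • e i - ((b n : ℝ) * (n : ℝ) ^ (i - b n)) • e (i - b n)
  relD : ∀ r n i : ℕ, r < n → n * a n + r * b n < i → i < (r + 1) * (a n + b n) →
    f i = ((n : ℝ) ^ i *
      (2 : ℝ) ^ ((((r : ℝ) + 1 / 2) * (b n : ℝ) - (i : ℝ)) / √(b n : ℝ))) • e i

/-- `T` is a bounded operator on `ℓ₁` that extends the linear map `F → F`, `eᵢ ↦ eᵢ₊₁`. -/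
def IsReadOperator (a b : ℕ → ℕ) (T : Ell1 →L[ℝ] Ell1) : Prop :=
  ∃ e : ℕ → Ell1, IsReadSequence a b e ∧ ∀ i, T (e i) = e (i + 1)

/-- A positive operator on the Banach lattice `ℓ₁` (ordered coordinatewise). -/
def IsPositiveOp (S : Ell1 →L[ℝ] Ell1) : Prop :=
  ∀ x : Ell1, (∀ i, 0 ≤ x i) → ∀ i, 0 ≤ S x i

/-- `S = T⁻`, that is, `S` is the least upper bound of `-T` and `0` in the ordered space of
bounded operators on `ℓ₁`, where `A ≤ B` means that `B - A` is positive. -/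
def IsNegativePart (T S : Ell1 →L[ℝ] Ell1) : Prop :=
  IsPositiveOp S ∧ IsPositiveOp (S + T) ∧
    ∀ U : Ell1 →L[ℝ] Ell1, IsPositiveOp U → IsPositiveOp (U + T) → IsPositiveOp (U - S)

/-- The matrix entry `s_{kj} = (S fⱼ)ₖ`. -/
def entry (S : Ell1 →L[ℝ] Ell1) (k j : ℕ) : ℝ := S (f j) k

/-- The sup-norm of the `k`-th row of the matrix of `S`
(the entries of the matrix are bounded by `‖S‖`). -/
def rowNorm (S : Ell1 →L[ℝ] Ell1) (k : ℕ) : ℝ := ⨆ j, |entry S k j|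

section Nuclear

variable {X Y : Type*} [NormedAddCommGroup X] [NormedSpace ℝ X]
  [NormedAddCommGroup Y] [NormedSpace ℝ Y]

/-- `S = ∑ᵢ φᵢ ⊗ yᵢ` with `∑ᵢ ‖φᵢ‖ ‖yᵢ‖ < ∞`, where `(φ ⊗ y)(x) = φ(x) y`. -/
def IsNuclearRep (S : X →L[ℝ] Y) (φ : ℕ → X →L[ℝ] ℝ) (y : ℕ → Y) : Prop :=
  Summable (fun i => ‖φ i‖ * ‖y i‖) ∧ HasSum (fun i => (φ i).smulRight (y i)) S

/-- Nuclear operators between Banach spaces. -/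
def IsNuclear (S : X →L[ℝ] Y) : Prop :=
  ∃ (φ : ℕ → X →L[ℝ] ℝ) (y : ℕ → Y), IsNuclearRep S φ y

/-- The nuclear norm (meaningful for nuclear operators). -/
def nuclearNorm (S : X →L[ℝ] Y) : ℝ :=
  sInf {t : ℝ | ∃ (φ : ℕ → X →L[ℝ] ℝ) (y : ℕ → Y),
    IsNuclearRep S φ y ∧ t = ∑' i, ‖φ i‖ * ‖y i‖}

end Nuclear

end

end Read

/-!
Relative to the basis `(fᵢ)`, the operator is a matrix that can be written down column by column.
The relations read `fᵢ = λᵢ eᵢ - μᵢ eₛ` with `λᵢ > 0`, `μᵢ ≥ 0`, and `s < i` whenever `μᵢ ≠ 0`.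
This triangular system has exactly one solution `(eᵢ)` (`IsRapid.exists_isReadSequence`,
`IsRapid.readSequence_unique`), and the solution is positive (`IsRapid.e_nonneg`). The operator
must send `fᵢ` to `λᵢ eᵢ₊₁ - μᵢ eₛ₊₁` (`column`).

* If `i` and `i + 1` lie in the same interval, or if `i = 0`, the column is a positive
  multiple of `fᵢ₊₁`, with a factor at most `2`.
* If `i` is the last index of an interval of B) or D), then `μᵢ = 0` and the column is a positive
  multiple of `eᵢ₊₁`, so it is positive. Its norm is at most `2`, because `nⁱ⁺¹ ‖eᵢ₊₁‖` is at most
  `2` in case B) and at most polynomial in `bₙ` in case D) (`IsRapid.norm_e_le`), while `n⁻ⁱ λᵢ`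
  is roughly `2 ^ (-√aₙ / 2)` or `2 ^ (-√bₙ / 2)`.
* If `i` is the last index of an interval of A) or C), then both `i + 1` and `s + 1` lie at the
  beginning of an interval of B) or D), where `e` is a small multiple of `f`. Hence the column is
  `p fᵢ₊₁ - c fₛ₊₁`, and this is the only source of negative entries
  (`IsRapid.column_A_end`, `IsRapid.column_C_end`).

So the columns are bounded, and they define the operator (`exists_clm_of_columns`). The negative
part of an operator on `ℓ₁` is the entrywise negative part of its matrix
(`exists_isNegativePart`). An operator on `ℓ₁` whose rows have summable sup-norms is nuclear, as
the sum of the rank-one operators given by its rows (`isNuclearRep_rows`). For rapidly increasing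
data, every entry in row `k` of the negative part is at most `1 / ((k + 1) (k + 2))`
(`IsRapid.rowNorm_le`), and these numbers have sum `1`.
-/

namespace Read

/-! ### Operators on `ℓ₁` given by matrices -/

theorem f_apply (i k : ℕ) : f i k = if k = i then 1 else 0 := by
  unfold f
  rw [lp.single_apply]
  split_ifs with h
  · subst h; simp
  · simp [h]

theorem f_apply_nonneg (i k : ℕ) : 0 ≤ f i k := by
  rw [f_apply]; split_ifs <;> norm_num

theorem norm_f (i : ℕ) : ‖f i‖ = 1 := by
  unfold f
  rw [lp.norm_single (by norm_num)]
  simp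

theorem hasSum_smul_f (x : Ell1) : HasSum (fun i => x i • f i) x := by
  have h := lp.hasSum_single (p := 1) (by norm_num) x
  convert h using 2 with i
  unfold f
  rw [← lp.single_smul]
  simp

theorem hasSum_abs (x : Ell1) : HasSum (fun i => |x i|) ‖x‖ := by
  have h := lp.hasSum_norm (p := 1) (by norm_num) x
  simpa using h

/-- The coordinate functional `x ↦ xₖ`. -/
noncomputable def coord (k : ℕ) : Ell1 →L[ℝ] ℝ :=
  LinearMap.mkContinuous
    { toFun := fun x => x k
      map_add' := fun _ _ => rfl
      map_smul' := fun _ _ => rfl } 1 (fun x => by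
        rw [one_mul]; exact lp.norm_apply_le_norm (p := 1) (by norm_num) x k)

theorem hasSum_apply {E : Type*} [NormedAddCommGroup E] [NormedSpace ℝ E]
    (S : Ell1 →L[ℝ] E) (x : Ell1) : HasSum (fun j => x j • S (f j)) (S x) := by
  simpa using S.hasSum (hasSum_smul_f x)

theorem clm_ext {E : Type*} [NormedAddCommGroup E] [NormedSpace ℝ E]
    {S T : Ell1 →L[ℝ] E} (h : ∀ j, S (f j) = T (f j)) : S = T := by
  ext1 x
  have hS := hasSum_apply S x
  simp only [h] at hS
  exact hS.unique (hasSum_apply T x)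

theorem opNorm_le_of_columns {E : Type*} [NormedAddCommGroup E] [NormedSpace ℝ E]
    (S : Ell1 →L[ℝ] E) {M : ℝ} (hM : 0 ≤ M) (h : ∀ j, ‖S (f j)‖ ≤ M) : ‖S‖ ≤ M := by
  refine S.opNorm_le_bound hM fun x => ?_
  have hx := (hasSum_abs x).mul_left M
  refine (hasSum_apply S x).norm_le_of_bounded hx fun j => ?_
  rw [norm_smul, mul_comm, Real.norm_eq_abs]
  exact mul_le_mul_of_nonneg_right (h j) (abs_nonneg _)

/-- A bounded sequence of columns is the matrix of a bounded operator on `ℓ₁`. -/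
theorem exists_clm_of_columns (g : ℕ → Ell1) {M : ℝ} (hg : ∀ j, ‖g j‖ ≤ M) :
    ∃ T : Ell1 →L[ℝ] Ell1, ∀ j, T (f j) = g j := by
  have hb : ∀ (x : Ell1) j, ‖x j • g j‖ ≤ M * |x j| := fun x j => by
    rw [norm_smul, mul_comm, Real.norm_eq_abs]
    exact mul_le_mul_of_nonneg_right (hg j) (abs_nonneg _)
  have hs : ∀ x : Ell1, Summable fun j => x j • g j := fun x =>
    Summable.of_norm_bounded ((hasSum_abs x).mul_left M).summable (hb x)
  refine ⟨LinearMap.mkContinuous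
    { toFun := fun x => ∑' j, x j • g j
      map_add' := fun x y => ?_
      map_smul' := fun c x => ?_ } M fun x => ?_, fun j => ?_⟩
  · rw [← (hs x).tsum_add (hs y)]
    simp [add_smul]
  · rw [RingHom.id_apply, ← (hs x).tsum_const_smul c]
    simp [mul_smul]
  · exact (hs x).hasSum.norm_le_of_bounded ((hasSum_abs x).mul_left M) (hb x)
  · simp only [LinearMap.mkContinuous_apply, LinearMap.coe_mk, AddHom.coe_mk]
    rw [tsum_eq_single j fun i hi => by simp [f_apply, hi]]
    simp [f_apply]

theorem isPositiveOp_iff (S : Ell1 →L[ℝ] Ell1) : IsPositiveOp S ↔ ∀ k j, 0 ≤ entry S k j := by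
  refine ⟨fun h k j => h (f j) (f_apply_nonneg j) k, fun h x hx k => ?_⟩
  have := hasSum_apply ((coord k).comp S) x
  exact this.nonneg fun j => mul_nonneg (hx j) (h k j)

/-- Every bounded operator on `ℓ₁` has a negative part, whose matrix is the entrywise negative
part: the negative part of each column has at most the norm of that column. -/
theorem exists_isNegativePart (T : Ell1 →L[ℝ] Ell1) :
    ∃ S : Ell1 →L[ℝ] Ell1, IsNegativePart T S ∧
      ∀ k j, entry S k j = max (-entry T k j) 0 := by
  have hle : ∀ t : ℝ, |max (-t) 0| ≤ |t| := fun t => by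
    rw [abs_of_nonneg (le_max_right _ _)]
    exact max_le (neg_le_abs t) (abs_nonneg t)
  have hmem : ∀ j, Memℓp (E := fun _ => ℝ) (fun k => max (-(T (f j) k)) 0) 1 := fun j => by
    refine memℓp_gen ?_
    simpa using Summable.of_nonneg_of_le (fun _ => abs_nonneg _) (fun k => hle _)
      (hasSum_abs (T (f j))).summable
  let g : ℕ → Ell1 := fun j => ⟨_, hmem j⟩
  have hg : ∀ j, ‖g j‖ ≤ ‖T‖ := fun j => by
    refine (hasSum_le (fun k => hle _) (hasSum_abs (g j)) (hasSum_abs (T (f j)))).trans ?_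
    simpa [norm_f] using T.le_opNorm (f j)
  obtain ⟨S, hS⟩ := exists_clm_of_columns g hg
  have hent : ∀ k j, entry S k j = max (-entry T k j) 0 := fun k j => by
    unfold entry; rw [hS]
  have hadd : ∀ (A B : Ell1 →L[ℝ] Ell1) k j, entry (A + B) k j = entry A k j + entry B k j :=
    fun A B k j => rfl
  have hsub : ∀ (A B : Ell1 →L[ℝ] Ell1) k j, entry (A - B) k j = entry A k j - entry B k j :=
    fun A B k j => rfl
  refine ⟨S, ⟨?_, ?_, fun U hU hUT => ?_⟩, hent⟩
  · rw [isPositiveOp_iff]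
    intro k j; rw [hent]; exact le_max_right _ _
  · rw [isPositiveOp_iff]
    intro k j; rw [hadd, hent]; linarith [le_max_left (-entry T k j) 0]
  · rw [isPositiveOp_iff] at hU hUT ⊢
    intro k j
    have h1 := hU k j
    have h2 := hUT k j
    rw [hadd] at h2
    rw [hsub, hent, sub_nonneg]
    exact max_le (by linarith) h1

theorem abs_entry_le (S : Ell1 →L[ℝ] Ell1) (k j : ℕ) : |entry S k j| ≤ ‖S‖ := by
  refine (lp.norm_apply_le_norm (p := 1) (by norm_num) (S (f j)) k).trans ?_
  simpa [norm_f] using S.le_opNorm (f j)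

theorem abs_entry_le_rowNorm (S : Ell1 →L[ℝ] Ell1) (k j : ℕ) : |entry S k j| ≤ rowNorm S k :=
  le_ciSup (f := fun j => |entry S k j|)
    ⟨‖S‖, by rintro _ ⟨j, rfl⟩; exact abs_entry_le S k j⟩ j

theorem rowNorm_nonneg (S : Ell1 →L[ℝ] Ell1) (k : ℕ) : 0 ≤ rowNorm S k :=
  (abs_nonneg _).trans (abs_entry_le_rowNorm S k 0)

/-- The dual of `ℓ₁` is `ℓ_∞`: the norm of a row, as a functional, is at most its sup-norm. -/
theorem norm_row_le (S : Ell1 →L[ℝ] Ell1) (k : ℕ) : ‖(coord k).comp S‖ ≤ rowNorm S k :=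
  opNorm_le_of_columns _ (rowNorm_nonneg S k) fun j => abs_entry_le_rowNorm S k j

/-- If the row norms are summable, then expanding an operator on `ℓ₁` along its rows is a
nuclear representation. -/
theorem isNuclearRep_rows {S : Ell1 →L[ℝ] Ell1} (hS : Summable (rowNorm S)) :
    IsNuclearRep S (fun k => (coord k).comp S) f := by
  have hs : Summable fun k => ‖(coord k).comp S‖ * ‖f k‖ :=
    Summable.of_nonneg_of_le (fun k => by positivity)
      (fun k => by rw [norm_f, mul_one]; exact norm_row_le S k) hS
  refine ⟨hs, ?_⟩
  have hsum : Summable fun k => ((coord k).comp S).smulRight (f k) :=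
    Summable.of_norm_bounded hs fun k => by rw [ContinuousLinearMap.norm_smulRight_apply]
  convert hsum.hasSum
  ext1 x
  have h1 := ContinuousLinearMap.hasSum (ContinuousLinearMap.apply ℝ Ell1 x) hsum.hasSum
  exact (hasSum_smul_f (S x)).unique h1

theorem nuclearNorm_le_tsum_rowNorm {S : Ell1 →L[ℝ] Ell1} (hS : Summable (rowNorm S)) :
    nuclearNorm S ≤ ∑' k, rowNorm S k := by
  have hrep := isNuclearRep_rows hS
  have h1 : nuclearNorm S ≤ ∑' k, ‖(coord k).comp S‖ * ‖f k‖ := by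
    refine csInf_le ⟨0, ?_⟩ ⟨_, _, hrep, rfl⟩
    rintro t ⟨φ, y, -, rfl⟩
    exact tsum_nonneg fun i => by positivity
  refine h1.trans (hrep.1.tsum_le_tsum (fun k => ?_) hS)
  rw [norm_f, mul_one]
  exact norm_row_le S k

theorem IsNuclear.isCompactOperator {X Y : Type*} [NormedAddCommGroup X] [NormedSpace ℝ X]
    [NormedAddCommGroup Y] [NormedSpace ℝ Y] [CompleteSpace Y] {S : X →L[ℝ] Y}
    (hS : IsNuclear S) : IsCompactOperator S := by
  obtain ⟨φ, y, -, h⟩ := hS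
  refine isCompactOperator_of_tendsto (l := Filter.atTop) h
    (Filter.Eventually.of_forall fun s => ?_)
  refine Submodule.sum_mem (compactOperator (RingHom.id ℝ) X Y) fun i _ => ?_
  exact (isCompactOperator_of_locallyCompactSpace_rng
    (ContinuousLinearMap.toSpanSingleton ℝ (y i))).comp_clm (φ i)

/-! ### The intervals of indices and the coefficients of the relations -/

/-- The factor `2 ^ ((s - x / 2) / √x)`, which decays faster than any power of `x` for fixed
`s`. -/
noncomputable def decay (s x : ℝ) : ℝ := (2 : ℝ) ^ ((s - x / 2) / √x)

/-- What "increasing sufficiently rapidly" has to provide: `v_lt` and `na_lt` make the intervals of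
A)–D) disjoint and those of B) and D) nonempty, `decay_a` and `decay_b` make the entries of the
negative part small compared with their row indices, and `decay_b_pow` bounds the columns at the
right ends of the intervals of D). -/
structure IsRapid (a b : ℕ → ℕ) : Prop extends IsData a b where
  v_lt : ∀ n, v a b n + 1 < a (n + 1)
  na_lt : ∀ n, 1 ≤ n → n * a n + 1 < b n
  decay_a : ∀ n, (a n : ℝ) * ((v a b n : ℝ) + 3) ^ 2 * decay (1 + v a b n) (a (n + 1)) ≤ 1
  decay_b : ∀ n, 1 ≤ n →
    (b n : ℝ) * ((v a b n : ℝ) + 2) ^ 2 * decay (1 + (n : ℝ) * a n) (b n) ≤ 1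
  decay_b_pow : ∀ n, 1 ≤ n → ((b n : ℝ) + 1) ^ n * decay 1 (b n) ≤ 1

section Indices

variable {a b : ℕ → ℕ}

theorem v_zero : v a b 0 = 0 := by simp [v]

theorem IsRapid.a_pos (h : IsRapid a b) (n : ℕ) : 0 < a n := by
  cases n with
  | zero => rw [h.a_zero]; exact one_pos
  | succ n => have := h.v_lt n; omega

theorem IsRapid.b_pos (h : IsRapid a b) (n : ℕ) (hn : 1 ≤ n) : 0 < b n :=
  (h.a_pos n).trans (h.a_lt_b n hn)

theorem IsRapid.v_le_succ (h : IsRapid a b) (n : ℕ) : v a b n + 1 < v a b (n + 1) := by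
  have h1 := h.v_lt n
  have : a (n + 1) ≤ v a b (n + 1) := by
    unfold v; nlinarith [Nat.zero_le (n * (a (n + 1) + b (n + 1))), Nat.zero_le (b (n + 1))]
  omega

theorem IsRapid.v_mono (h : IsRapid a b) : StrictMono (v a b) :=
  strictMono_nat_of_lt_succ fun n => by have := h.v_le_succ n; omega

theorem IsRapid.a_mono (h : IsRapid a b) : Monotone a := by
  refine monotone_nat_of_le_succ fun n => ?_
  rcases Nat.eq_zero_or_pos n with rfl | hn
  · rw [h.a_zero]; exact h.a_pos 1
  · exact ((h.a_lt_b n hn).trans (h.b_lt_a n hn)).le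

theorem IsRapid.v_add_one_lt_a (h : IsRapid a b) {m n : ℕ} (hmn : m < n) :
    v a b m + 1 < a n := by
  obtain ⟨k, rfl⟩ : ∃ k, n = k + 1 := ⟨n - 1, by omega⟩
  exact lt_of_le_of_lt (Nat.add_le_add_right (h.v_mono.monotone (by omega)) 1) (h.v_lt k)

/-- The least `n` with `i ≤ vₙ`. -/
noncomputable def block (a b : ℕ → ℕ) (i : ℕ) : ℕ := sInf {n | i ≤ v a b n}

theorem IsRapid.block_eq (h : IsRapid a b) {n i : ℕ} (h1 : v a b (n - 1) < i)
    (h2 : i ≤ v a b n) : block a b i = n := by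
  refine le_antisymm (Nat.sInf_le h2) (le_csInf ⟨n, h2⟩ fun m hm => ?_)
  by_contra hlt
  have := h.v_mono.monotone (show m ≤ n - 1 by omega)
  have hm' : i ≤ v a b m := hm
  omega

theorem IsRapid.exists_block (h : IsRapid a b) {i : ℕ} (hi : 0 < i) :
    ∃ n, 1 ≤ n ∧ v a b (n - 1) < i ∧ i ≤ v a b n := by
  have hex : ∃ n, i ≤ v a b n := ⟨i, h.v_mono.le_apply⟩
  classical
  refine ⟨Nat.find hex, ?_, ?_, Nat.find_spec hex⟩
  · rw [Nat.one_le_iff_ne_zero]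
    intro h0
    have := Nat.find_spec hex
    rw [h0, v_zero] at this
    omega
  · have h1 : Nat.find hex ≠ 0 := by
      intro h0
      have := Nat.find_spec hex
      rw [h0, v_zero] at this
      omega
    exact not_le.1 (Nat.find_min hex (show Nat.find hex - 1 < Nat.find hex by omega))

/-- The coefficient `nⁱ 2 ^ (((r + 1/2) x - i) / √x)` of the relations B) and D), where `x` is
`aₙ` or `bₙ`. -/
noncomputable def weight (n r x i : ℕ) : ℝ :=
  (n : ℝ) ^ i * (2 : ℝ) ^ ((((r : ℝ) + 1 / 2) * (x : ℝ) - (i : ℝ)) / √(x : ℝ))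

/-- The triple `(λ, μ, s)` for which the relations read `fᵢ = λ eᵢ - μ eₛ`. The four branches
after the first are A), B), C) and D). -/
noncomputable def coeffs (a b : ℕ → ℕ) (i : ℕ) : ℝ × ℝ × ℕ :=
  let n := block a b i
  if i = 0 then (1, 0, 0)
  else if i ≤ n * a n then
    let r := i / a n
    if 0 < r ∧ i ≤ v a b (n - r) + r * a n then
      let c : ℝ := ((n : ℝ) - r) ^ (i - r * a n) * (a (n - r) : ℝ)
      (c * (n : ℝ) ^ (r * a n), c, i - r * a n)
    else (weight n r (a n) i, 0, 0)
  else
    let r := i / (a n + b n)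
    if 0 < r ∧ i ≤ n * a n + r * b n then
      ((n : ℝ) ^ i, (b n : ℝ) * (n : ℝ) ^ (i - b n), i - b n)
    else (weight n r (b n) i, 0, 0)

theorem coeffs_zero : coeffs a b 0 = (1, 0, 0) := by simp [coeffs]

theorem IsRapid.coeffs_A (h : IsRapid a b) {r n i : ℕ} (hr : 0 < r) (hrn : r ≤ n)
    (h1 : r * a n ≤ i) (h2 : i ≤ v a b (n - r) + r * a n) :
    coeffs a b i = (((n : ℝ) - r) ^ (i - r * a n) * (a (n - r) : ℝ) * (n : ℝ) ^ (r * a n),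
      ((n : ℝ) - r) ^ (i - r * a n) * (a (n - r) : ℝ), i - r * a n) := by
  have ha := h.a_pos n
  have hv : v a b (n - r) + 1 < a n := h.v_add_one_lt_a (by omega)
  have hv' : v a b (n - 1) + 1 < a n := h.v_add_one_lt_a (by omega)
  have hra : 1 * a n ≤ r * a n := Nat.mul_le_mul_right _ hr
  have hle : i ≤ n * a n := by
    rcases hrn.lt_or_eq with hlt | rfl
    · have := Nat.mul_le_mul_right (a n) (show r + 1 ≤ n from hlt)
      linarith
    · rw [Nat.sub_self, v_zero] at h2; omega
  have hb : block a b i = n := h.block_eq (by omega) (hle.trans (by unfold v; nlinarith))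
  have hd : i / a n = r := Nat.div_eq_of_lt_le h1 (by linarith)
  have hi : i ≠ 0 := by omega
  simp only [coeffs, hb, hd, hi, hle, hr, h2, if_true, if_false, and_self]

theorem IsRapid.coeffs_B (h : IsRapid a b) {r n i : ℕ} (hrn : r < n)
    (h1 : r * a n + v a b (n - max r 1) < i) (h2 : i < (r + 1) * a n) :
    coeffs a b i = (weight n r (a n) i, 0, 0) := by
  have ha := h.a_pos n
  have hv' : v a b (n - 1) + 1 < a n := h.v_add_one_lt_a (by omega)
  have hle : i ≤ n * a n := h2.le.trans (Nat.mul_le_mul_right _ hrn)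
  have hlow : v a b (n - 1) < i := by
    rcases Nat.eq_zero_or_pos r with rfl | hr
    · simpa using h1
    · have hra : 1 * a n ≤ r * a n := Nat.mul_le_mul_right _ hr
      omega
  have hb : block a b i = n := h.block_eq hlow (hle.trans (by unfold v; nlinarith))
  have hd : i / a n = r := Nat.div_eq_of_lt_le (by omega) h2
  have hi : i ≠ 0 := by omega
  have hA : ¬ (0 < r ∧ i ≤ v a b (n - r) + r * a n) := by
    rintro ⟨hr, h3⟩
    rw [max_eq_left (by omega : 1 ≤ r)] at h1
    omega
  simp only [coeffs, hb, hd, hi, hle, if_true, if_false, if_neg hA]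

theorem IsRapid.coeffs_C (h : IsRapid a b) {r n i : ℕ} (hr : 0 < r) (hrn : r ≤ n)
    (h1 : r * (a n + b n) ≤ i) (h2 : i ≤ n * a n + r * b n) :
    coeffs a b i = ((n : ℝ) ^ i, (b n : ℝ) * (n : ℝ) ^ (i - b n), i - b n) := by
  have ha := h.a_pos n
  have hb := h.na_lt n (by omega)
  have hv' : v a b (n - 1) + 1 < a n := h.v_add_one_lt_a (by omega)
  have hra : 1 * (a n + b n) ≤ r * (a n + b n) := Nat.mul_le_mul_right _ hr
  have hrb : r * b n ≤ n * b n := Nat.mul_le_mul_right _ hrn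
  have hbl : block a b i = n := h.block_eq (by omega) (by unfold v; linarith)
  have hle : ¬ i ≤ n * a n := by omega
  have hd : i / (a n + b n) = r := Nat.div_eq_of_lt_le h1 (by nlinarith)
  have hi : i ≠ 0 := by omega
  simp only [coeffs, hbl, hd, hi, hle, hr, h2, if_true, if_false, and_self]

theorem IsRapid.coeffs_D (h : IsRapid a b) {r n i : ℕ} (hrn : r < n)
    (h1 : n * a n + r * b n < i) (h2 : i < (r + 1) * (a n + b n)) :
    coeffs a b i = (weight n r (b n) i, 0, 0) := by
  have ha := h.a_pos n
  have hv' : v a b (n - 1) + 1 < a n := h.v_add_one_lt_a (by omega)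
  have hna : 1 * a n ≤ n * a n := Nat.mul_le_mul_right _ (by omega)
  have hup : i ≤ v a b n := h2.le.trans (Nat.mul_le_mul_right _ hrn)
  have hbl : block a b i = n := h.block_eq (by omega) hup
  have hle : ¬ i ≤ n * a n := by omega
  have hra : r * a n ≤ n * a n := Nat.mul_le_mul_right _ hrn.le
  have hd : i / (a n + b n) = r := Nat.div_eq_of_lt_le (by linarith) h2
  have hi : i ≠ 0 := by omega
  have hC : ¬ (0 < r ∧ i ≤ n * a n + r * b n) := by omega
  simp only [coeffs, hbl, hd, hi, hle, if_false, if_neg hC]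

/-- The intervals of indices in A)–D). In `B` the case `r = 0` is the second interval of B): the
lower bound `r aₙ + vₙ₋ᵣ` is then replaced by `vₙ₋₁`, which is why `max r 1` appears. -/
inductive Slot (a b : ℕ → ℕ) : ℕ → Prop
  | zero : Slot a b 0
  | A (r n i : ℕ) : 0 < r → r ≤ n → r * a n ≤ i → i ≤ v a b (n - r) + r * a n → Slot a b i
  | B (r n i : ℕ) : r < n → r * a n + v a b (n - max r 1) < i → i < (r + 1) * a n → Slot a b i
  | C (r n i : ℕ) : 0 < r → r ≤ n → r * (a n + b n) ≤ i → i ≤ n * a n + r * b n → Slot a b i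
  | D (r n i : ℕ) : r < n → n * a n + r * b n < i → i < (r + 1) * (a n + b n) → Slot a b i

/-- The intervals of A)–D), together with `{0}`, cover all indices. -/
theorem IsRapid.slot (h : IsRapid a b) (i : ℕ) : Slot a b i := by
  rcases Nat.eq_zero_or_pos i with rfl | hi
  · exact .zero
  obtain ⟨n, hn, h1, h2⟩ := h.exists_block hi
  have ha := h.a_pos n
  by_cases hle : i ≤ n * a n
  · have hlt : i < (i / a n + 1) * a n := by rw [mul_comm]; exact Nat.lt_mul_div_succ i ha
    have hge : i / a n * a n ≤ i := Nat.div_mul_le_self _ _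
    have hrn : i / a n ≤ n := Nat.div_le_of_le_mul (by rwa [mul_comm])
    generalize i / a n = r at *
    rcases Nat.eq_zero_or_pos r with rfl | hr
    · exact .B 0 n i (by omega) (by simpa using h1) hlt
    by_cases hA : i ≤ v a b (n - r) + r * a n
    · exact .A r n i hr hrn hge hA
    · rcases hrn.lt_or_eq with hrn | rfl
      · exact .B r n i hrn (by rw [max_eq_left (by omega : 1 ≤ r)]; omega) hlt
      · exact absurd (hle.trans (Nat.le_add_left _ _)) hA
  · have hab : 0 < a n + b n := by omega
    have hlt : i < (i / (a n + b n) + 1) * (a n + b n) := by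
      rw [mul_comm]; exact Nat.lt_mul_div_succ i hab
    have hge : i / (a n + b n) * (a n + b n) ≤ i := Nat.div_mul_le_self _ _
    have hrn : i / (a n + b n) ≤ n := Nat.div_le_of_le_mul (by rw [mul_comm]; exact h2)
    generalize i / (a n + b n) = r at *
    by_cases hC : i ≤ n * a n + r * b n
    · rcases Nat.eq_zero_or_pos r with rfl | hr
      · omega
      · exact .C r n i hr hrn hge hC
    · rcases hrn.lt_or_eq with hrn | rfl
      · exact .D r n i hrn (by omega) hlt
      · unfold v at h2; exact absurd (by linarith) hC

end Indices

/-! ### The sequence `(eᵢ)` -/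

section Sequence

variable {a b : ℕ → ℕ} {e : ℕ → Ell1}

/-- The coefficient of `eᵢ` in the `i`-th relation. -/
noncomputable def lam (a b : ℕ → ℕ) (i : ℕ) : ℝ := (coeffs a b i).1

/-- Minus the coefficient of the earlier vector in the `i`-th relation. -/
noncomputable def mu (a b : ℕ → ℕ) (i : ℕ) : ℝ := (coeffs a b i).2.1

/-- The index of the earlier vector in the `i`-th relation; it is `0`, with coefficient `0`, if
there is none. -/
noncomputable def src (a b : ℕ → ℕ) (i : ℕ) : ℕ := (coeffs a b i).2.2

/-- Since the intervals of A)–D) are disjoint and cover all indices, the relations amount to exactly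
one relation for each index. -/
theorem IsRapid.isReadSequence_iff (h : IsRapid a b) :
    IsReadSequence a b e ↔
      (∀ i, e i ∈ F) ∧ ∀ i, f i = lam a b i • e i - mu a b i • e (src a b i) := by
  simp only [lam, mu, src]
  refine ⟨fun he => ⟨he.mem_F, fun i => ?_⟩, fun ⟨hF, he⟩ => ⟨hF, ?_, ?_, ?_, ?_, ?_, ?_⟩⟩
  · rcases h.slot i with _ | ⟨r, n, _, hr, hrn, h1, h2⟩ | ⟨r, n, _, hrn, h1, h2⟩ |
      ⟨r, n, _, hr, hrn, h1, h2⟩ | ⟨r, n, _, hrn, h1, h2⟩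
    · rw [coeffs_zero, he.zero]; simp
    · rw [h.coeffs_A hr hrn h1 h2, he.relA r n i hr hrn h1 h2, smul_sub, smul_smul]
    · rw [h.coeffs_B hrn h1 h2]
      rcases Nat.eq_zero_or_pos r with rfl | hr
      · rw [he.relB' n i (by omega) (by simpa using h1) (by simpa using h2)]
        simp [weight]
      · rw [he.relB r n i hr hrn (by rwa [max_eq_left (by omega : 1 ≤ r)] at h1) h2]
        simp [weight]
    · rw [h.coeffs_C hr hrn h1 h2, he.relC r n i hr hrn h1 h2]
    · rw [h.coeffs_D hrn h1 h2, he.relD r n i hrn h1 h2]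
      simp [weight]
  · rw [he 0, coeffs_zero]; simp
  · intro r n i hr hrn h1 h2
    rw [he i, h.coeffs_A hr hrn h1 h2, smul_sub, smul_smul]
  · intro r n i hr hrn h1 h2
    rw [he i, h.coeffs_B hrn (by rwa [max_eq_left (by omega : 1 ≤ r)]) h2]
    simp [weight]
  · intro n i hn h1 h2
    rw [he i, h.coeffs_B (r := 0) (n := n) (by omega) (by simpa using h1) (by simpa using h2)]
    simp [weight]
  · intro r n i hr hrn h1 h2
    rw [he i, h.coeffs_C hr hrn h1 h2]
  · intro r n i hrn h1 h2
    rw [he i, h.coeffs_D hrn h1 h2]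
    simp [weight]

theorem weight_pos {n : ℕ} (hn : 1 ≤ n) (r x i : ℕ) : 0 < weight n r x i := by
  unfold weight; positivity

/-- The relations are triangular with positive diagonal, and all their right-hand sides have
the form `λ eᵢ - μ eₛ` with `μ ≥ 0`. -/
theorem IsRapid.coeffs_pos (h : IsRapid a b) (i : ℕ) :
    0 < lam a b i ∧ 0 ≤ mu a b i ∧ (src a b i < i ∨ mu a b i = 0) := by
  simp only [lam, mu, src]
  rcases h.slot i with _ | ⟨r, n, _, hr, hrn, h1, h2⟩ | ⟨r, n, _, hrn, h1, h2⟩ |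
      ⟨r, n, _, hr, hrn, h1, h2⟩ | ⟨r, n, _, hrn, h1, h2⟩
  · simp [coeffs_zero]
  · rw [h.coeffs_A hr hrn h1 h2]
    have hn : (0 : ℝ) < n := by exact_mod_cast (by omega : 0 < n)
    have ha : (0 : ℝ) < a (n - r) := by exact_mod_cast h.a_pos _
    have hc : 0 < ((n : ℝ) - r) ^ (i - r * a n) := by
      rcases hrn.lt_or_eq with hlt | rfl
      · exact pow_pos (by rw [sub_pos]; exact_mod_cast hlt) _
      · rw [Nat.sub_self, v_zero] at h2
        rw [show i - r * a r = 0 by omega]; simp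
    have hra : 1 * a n ≤ r * a n := Nat.mul_le_mul_right _ hr
    have := h.a_pos n
    exact ⟨by positivity, by positivity, .inl (by simp only; omega)⟩
  · rw [h.coeffs_B hrn h1 h2]
    exact ⟨weight_pos (by omega) _ _ _, le_rfl, .inr rfl⟩
  · rw [h.coeffs_C hr hrn h1 h2]
    have hn : (0 : ℝ) < n := by exact_mod_cast (by omega : 0 < n)
    have hra : 1 * (a n + b n) ≤ r * (a n + b n) := Nat.mul_le_mul_right _ hr
    have := h.a_pos n
    have := h.na_lt n (by omega)
    exact ⟨by positivity, by positivity, .inl (by simp only; omega)⟩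
  · rw [h.coeffs_D hrn h1 h2]
    exact ⟨weight_pos (by omega) _ _ _, le_rfl, .inr rfl⟩

/-- The relations, solved for `eᵢ`. -/
theorem IsRapid.eq_of_relation (h : IsRapid a b)
    (he : ∀ i, f i = lam a b i • e i - mu a b i • e (src a b i)) (i : ℕ) :
    e i = (lam a b i)⁻¹ • (f i + mu a b i • e (src a b i)) := by
  rw [he i, sub_add_cancel, smul_smul, inv_mul_cancel₀ (h.coeffs_pos i).1.ne', one_smul]

/-- Solve the triangular relations recursively. -/
theorem IsRapid.exists_isReadSequence (h : IsRapid a b) : ∃ e, IsReadSequence a b e := by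
  let step : (i : ℕ) → ((j : ℕ) → j < i → Ell1) → Ell1 := fun i prev =>
    (lam a b i)⁻¹ • (f i + if hs : src a b i < i then mu a b i • prev _ hs else 0)
  let e : ℕ → Ell1 := fun i => Nat.strongRec step i
  have he : ∀ i, e i = step i fun j _ => e j := fun i => by
    simp only [e]
    rw [Nat.strongRec]
  have he' : ∀ i, e i = (lam a b i)⁻¹ • (f i + mu a b i • e (src a b i)) := fun i => by
    rw [he i]
    simp only [step]
    split_ifs with hs
    · rfl
    · rw [((h.coeffs_pos i).2.2.resolve_left hs), zero_smul]
  refine ⟨e, h.isReadSequence_iff.2 ⟨fun i => ?_, fun i => ?_⟩⟩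
  · induction i using Nat.strong_induction_on with
    | _ i ih =>
      rw [he' i]
      refine F.smul_mem _ (F.add_mem (Submodule.subset_span ⟨i, rfl⟩) ?_)
      rcases (h.coeffs_pos i).2.2 with hs | h0
      · exact F.smul_mem _ (ih _ hs)
      · rw [h0, zero_smul]; exact F.zero_mem
  · rw [he' i, smul_smul, mul_inv_cancel₀ (h.coeffs_pos i).1.ne', one_smul]
    rw [add_sub_cancel_right]

theorem IsRapid.readSequence_unique (h : IsRapid a b) {e e' : ℕ → Ell1}
    (he : IsReadSequence a b e) (he' : IsReadSequence a b e') : e = e' := by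
  have h1 := h.eq_of_relation (h.isReadSequence_iff.1 he).2
  have h2 := h.eq_of_relation (h.isReadSequence_iff.1 he').2
  funext i
  induction i using Nat.strong_induction_on with
  | _ i ih =>
    rw [h1 i, h2 i]
    rcases (h.coeffs_pos i).2.2 with hs | h0
    · rw [ih _ hs]
    · simp [h0]

/-- The vectors `eᵢ` are positive elements of the lattice `ℓ₁`. -/
theorem IsRapid.e_nonneg (h : IsRapid a b) (he : IsReadSequence a b e) (i k : ℕ) :
    0 ≤ e i k := by
  have h1 := h.eq_of_relation (h.isReadSequence_iff.1 he).2
  induction i using Nat.strong_induction_on with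
  | _ i ih =>
    obtain ⟨hl, hm, hs⟩ := h.coeffs_pos i
    have hmu : 0 ≤ mu a b i * e (src a b i) k := by
      rcases hs with hs | h0
      · exact mul_nonneg hm (ih _ hs)
      · rw [h0, zero_mul]
    rw [h1 i]
    exact mul_nonneg (inv_nonneg.2 hl.le) (add_nonneg (f_apply_nonneg i k) hmu)

/-- The image of `fᵢ` under the linear map `F → F`, `eᵢ ↦ eᵢ₊₁`. -/
noncomputable def column (a b : ℕ → ℕ) (e : ℕ → Ell1) (i : ℕ) : Ell1 :=
  lam a b i • e (i + 1) - mu a b i • e (src a b i + 1)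

theorem IsRapid.apply_f (h : IsRapid a b) (he : IsReadSequence a b e) {T : Ell1 →L[ℝ] Ell1}
    (hT : ∀ i, T (e i) = e (i + 1)) (i : ℕ) : T (f i) = column a b e i := by
  rw [(h.isReadSequence_iff.1 he).2 i, map_sub, map_smul, map_smul, hT, hT, column]

theorem IsRapid.apply_e (h : IsRapid a b) (he : IsReadSequence a b e) {T : Ell1 →L[ℝ] Ell1}
    (hT : ∀ i, T (f i) = column a b e i) (i : ℕ) : T (e i) = e (i + 1) := by
  induction i using Nat.strong_induction_on with
  | _ i ih =>
    obtain ⟨hl, -, hs⟩ := h.coeffs_pos i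
    have hmu : mu a b i • T (e (src a b i)) = mu a b i • e (src a b i + 1) := by
      rcases hs with hs | h0
      · rw [ih _ hs]
      · rw [h0, zero_smul, zero_smul]
    have h1 := h.eq_of_relation (h.isReadSequence_iff.1 he).2 i
    rw [h1, map_smul, map_add, map_smul, hT, hmu, column, sub_add_cancel, smul_smul,
      inv_mul_cancel₀ hl.ne', one_smul]

end Sequence

/-! ### The columns of the operator -/

section Columns

variable {a b : ℕ → ℕ} {e : ℕ → Ell1}

theorem decay_pos (s x : ℝ) : 0 < decay s x := by unfold decay; positivity

theorem decay_mono {s t : ℝ} (h : s ≤ t) (x : ℝ) : decay s x ≤ decay t x := by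
  unfold decay
  refine Real.rpow_le_rpow_of_exponent_le one_le_two ?_
  gcongr

theorem decay_le_one {s x : ℝ} (h : s ≤ x / 2) : decay s x ≤ 1 :=
  Real.rpow_le_one_of_one_le_of_nonpos one_le_two
    (div_nonpos_of_nonpos_of_nonneg (by linarith) (Real.sqrt_nonneg _))

/-- The weight at distance `s` below `(r + 1) x`, up to the power of `n`: small near the right end
of the interval. -/
theorem weight_eq_decay {n r x i : ℕ} {s : ℝ} (hi : (i : ℝ) = (r + 1) * x - s) :
    weight n r x i = (n : ℝ) ^ i * decay s x := by
  unfold weight decay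
  rw [show ((r : ℝ) + 1 / 2) * x - i = s - x / 2 by rw [hi]; ring]

/-- The inverse weight at distance `s` above `r x`, up to the power of `n`: small near the left end
of the interval. -/
theorem weight_inv_eq_decay {n r x i : ℕ} {s : ℝ} (hi : (i : ℝ) = r * x + s) :
    (weight n r x i)⁻¹ = ((n : ℝ) ^ i)⁻¹ * decay s x := by
  unfold weight decay
  rw [mul_inv, ← Real.rpow_neg zero_le_two, ← neg_div,
    show -(((r : ℝ) + 1 / 2) * x - i) = s - x / 2 by rw [hi]; ring]

/-- Inside an interval of B) or D), the operator multiplies by the quotient of consecutive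
weights, which is `n⁻¹ 2 ^ (1 / √x)`. -/
theorem weight_mul_inv_succ {n : ℕ} (hn : 1 ≤ n) {x : ℕ} (hx : 1 ≤ x) (r i : ℕ) :
    0 ≤ weight n r x i * (weight n r x (i + 1))⁻¹ ∧
      weight n r x i * (weight n r x (i + 1))⁻¹ ≤ 2 := by
  have h1 := weight_pos hn r x i
  have h2 := weight_pos hn r x (i + 1)
  refine ⟨by positivity, ?_⟩
  rw [← div_eq_mul_inv, div_le_iff₀ h2]
  unfold weight
  have hx' : (1 : ℝ) ≤ √(x : ℝ) := by
    rw [Real.one_le_sqrt]; exact_mod_cast hx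
  have hn' : (1 : ℝ) ≤ n := by exact_mod_cast hn
  have hexp : (((r : ℝ) + 1 / 2) * x - i) / √(x : ℝ) ≤
      1 + (((r : ℝ) + 1 / 2) * x - ((i + 1 : ℕ) : ℝ)) / √(x : ℝ) := by
    push_cast
    rw [show (((r : ℝ) + 1 / 2) * x - i) = 1 + (((r : ℝ) + 1 / 2) * x - (i + 1)) by ring, add_div]
    gcongr
    exact div_le_one_of_le₀ hx' (by positivity)
  have hpow := Real.rpow_le_rpow_of_exponent_le one_le_two hexp
  rw [Real.rpow_add two_pos, Real.rpow_one] at hpow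
  calc _ ≤ (n : ℝ) ^ (i + 1) *
        (2 * (2 : ℝ) ^ ((((r : ℝ) + 1 / 2) * x - ((i + 1 : ℕ) : ℝ)) / √(x : ℝ))) := by
        gcongr
        exact Nat.le_succ i
    _ = _ := by ring

theorem IsRapid.e_B (h : IsRapid a b) (he : IsReadSequence a b e) {r n i : ℕ} (hrn : r < n)
    (h1 : r * a n + v a b (n - max r 1) < i) (h2 : i < (r + 1) * a n) :
    e i = (weight n r (a n) i)⁻¹ • f i := by
  have := h.eq_of_relation (h.isReadSequence_iff.1 he).2 i
  simpa [lam, mu, src, h.coeffs_B hrn h1 h2] using this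

theorem IsRapid.e_D (h : IsRapid a b) (he : IsReadSequence a b e) {r n i : ℕ} (hrn : r < n)
    (h1 : n * a n + r * b n < i) (h2 : i < (r + 1) * (a n + b n)) :
    e i = (weight n r (b n) i)⁻¹ • f i := by
  have := h.eq_of_relation (h.isReadSequence_iff.1 he).2 i
  simpa [lam, mu, src, h.coeffs_D hrn h1 h2] using this

theorem IsRapid.decay_a_le (h : IsRapid a b) {m n : ℕ} (hmn : m < n) :
    (a m : ℝ) * decay (1 + v a b m) (a n) ≤ 1 := by
  obtain ⟨k, rfl⟩ : ∃ k, n = k + 1 := ⟨n - 1, by omega⟩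
  refine le_trans ?_ (h.decay_a k)
  have h1 : (a m : ℝ) ≤ a k := by exact_mod_cast h.a_mono (by omega)
  have h2 : (v a b m : ℝ) ≤ v a b k := by exact_mod_cast h.v_mono.monotone (by omega)
  have h3 := decay_mono (add_le_add_right h2 1) (a (k + 1) : ℝ)
  have h4 : (1 : ℝ) ≤ ((v a b k : ℝ) + 3) ^ 2 := one_le_pow₀ (by
    linarith [Nat.cast_nonneg (α := ℝ) (v a b k)])
  have h5 := decay_pos (1 + v a b m) (a (k + 1) : ℝ)
  calc _ ≤ (a k : ℝ) * decay (1 + v a b k) (a (k + 1)) := by gcongr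
    _ ≤ (a k : ℝ) * ((v a b k : ℝ) + 3) ^ 2 * decay (1 + v a b k) (a (k + 1)) := by
      refine mul_le_mul_of_nonneg_right ?_ (decay_pos _ _).le
      exact le_mul_of_one_le_right (by positivity) h4

theorem IsRapid.decay_a_le_one (h : IsRapid a b) {m n : ℕ} (hmn : m < n) :
    decay (1 + v a b m) (a n) ≤ 1 := by
  refine le_trans ?_ (h.decay_a_le hmn)
  exact le_mul_of_one_le_left (decay_pos _ _).le (by exact_mod_cast h.a_pos m)

theorem IsRapid.decay_b_le_one (h : IsRapid a b) {n : ℕ} (hn : 1 ≤ n) :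
    decay (1 + (n : ℝ) * a n) (b n) ≤ 1 := by
  refine le_trans ?_ (h.decay_b n hn)
  refine le_mul_of_one_le_left (decay_pos _ _).le (one_le_mul_of_one_le_of_one_le ?_ ?_)
  · exact_mod_cast h.b_pos n hn
  · exact one_le_pow₀ (by linarith [Nat.cast_nonneg (α := ℝ) (v a b n)])

/-- Minus the negative entries of the operator in the rows `1 + vₘ`. -/
noncomputable def entryA (a b : ℕ → ℕ) (m : ℕ) : ℝ :=
  (((m : ℝ) + 1) ^ (1 + v a b m))⁻¹ * decay (1 + v a b m) (a (m + 1)) * a m *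
    (m : ℝ) ^ v a b m

/-- Minus the negative entries of the operator in the rows `n aₙ + (r - 1) bₙ + 1`. -/
noncomputable def entryC (a b : ℕ → ℕ) (n : ℕ) : ℝ :=
  (b n : ℝ) * (n : ℝ)⁻¹ * decay (1 + (n : ℝ) * a n) (b n)

theorem entryA_nonneg (m : ℕ) : 0 ≤ entryA a b m := by
  have := decay_pos (1 + v a b m) (a (m + 1) : ℝ)
  unfold entryA; positivity

theorem entryC_nonneg (n : ℕ) : 0 ≤ entryC a b n := by
  have := decay_pos (1 + (n : ℝ) * a n) (b n : ℝ)
  unfold entryC; positivity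

/-- The bound includes the case `m = j = 0`, where `0 ^ 0 = 1`. -/
theorem pow_ratio_le_one (m j : ℕ) : (((m : ℝ) + 1) ^ (1 + j))⁻¹ * (m : ℝ) ^ j ≤ 1 := by
  rw [inv_mul_le_iff₀ (by positivity), mul_one]
  calc (m : ℝ) ^ j ≤ ((m : ℝ) + 1) ^ j := by gcongr; linarith
    _ ≤ ((m : ℝ) + 1) ^ (1 + j) :=
      pow_le_pow_right₀ (by linarith [Nat.cast_nonneg (α := ℝ) m]) (by omega)

theorem IsRapid.entryA_le (h : IsRapid a b) (m : ℕ) :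
    entryA a b m ≤ 1 / ((((1 + v a b m : ℕ) : ℝ) + 1) * (((1 + v a b m : ℕ) : ℝ) + 2)) := by
  have hd := decay_pos (1 + v a b m) (a (m + 1) : ℝ)
  have h1 := pow_ratio_le_one m (v a b m)
  have hv : (0 : ℝ) ≤ v a b m := Nat.cast_nonneg _
  rw [le_div_iff₀ (by positivity)]
  push_cast
  calc entryA a b m * ((1 + v a b m + 1) * (1 + v a b m + 2))
      = ((((m : ℝ) + 1) ^ (1 + v a b m))⁻¹ * (m : ℝ) ^ v a b m) *
        (a m * ((1 + v a b m + 1) * (1 + v a b m + 2)) * decay (1 + v a b m) (a (m + 1))) := by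
        unfold entryA; ring
    _ ≤ 1 * (a m * ((v a b m : ℝ) + 3) ^ 2 * decay (1 + v a b m) (a (m + 1))) := by
        gcongr
        nlinarith
    _ ≤ 1 := by rw [one_mul]; exact h.decay_a m

theorem IsRapid.entryC_le (h : IsRapid a b) {n k : ℕ} (hn : 1 ≤ n) (hk : k ≤ v a b n) :
    entryC a b n ≤ 1 / (((k : ℝ) + 1) * ((k : ℝ) + 2)) := by
  have hd := decay_pos (1 + (n : ℝ) * a n) (b n : ℝ)
  have hn' : (n : ℝ)⁻¹ ≤ 1 := inv_le_one_of_one_le₀ (by exact_mod_cast hn)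
  have hk' : (k : ℝ) ≤ v a b n := by exact_mod_cast hk
  have hk0 : (0 : ℝ) ≤ k := Nat.cast_nonneg _
  rw [le_div_iff₀ (by positivity)]
  calc entryC a b n * (((k : ℝ) + 1) * (k + 2))
      = (n : ℝ)⁻¹ * (b n * (((k : ℝ) + 1) * (k + 2)) * decay (1 + (n : ℝ) * a n) (b n)) := by
        unfold entryC; ring
    _ ≤ 1 * (b n * ((v a b n : ℝ) + 2) ^ 2 * decay (1 + (n : ℝ) * a n) (b n)) := by
        gcongr
        nlinarith
    _ ≤ 1 := by rw [one_mul]; exact h.decay_b n hn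

/-- The columns at the right ends of the intervals of A): here the shift of `e_{i - r aₙ}` lands
at the beginning of an interval of B) and produces a negative entry. -/
theorem IsRapid.column_A_end (h : IsRapid a b) (he : IsReadSequence a b e) {r n : ℕ}
    (hr : 0 < r) (hrn : r ≤ n) :
    ∃ p : ℝ, 0 ≤ p ∧ p ≤ 1 ∧ column a b e (v a b (n - r) + r * a n) =
      p • f (v a b (n - r) + r * a n + 1) - entryA a b (n - r) • f (1 + v a b (n - r)) := by
  obtain ⟨m, rfl⟩ : ∃ m, n = m + r := ⟨n - r, by omega⟩
  have hn : 1 ≤ m + r := by omega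
  have hc := h.coeffs_A hr hrn (Nat.le_add_left _ _) le_rfl
  simp only [Nat.add_sub_cancel, Nat.cast_add, add_sub_cancel_right] at hc ⊢
  have ha := h.a_pos (m + r)
  set N := m + r with hN
  have hneg : e (v a b m + 1) = (weight (m + 1) 0 (a (m + 1)) (v a b m + 1))⁻¹ •
      f (v a b m + 1) :=
    h.e_B he (by omega) (by simp) (by simpa using h.v_lt m)
  rw [weight_inv_eq_decay (s := 1 + v a b m) (by push_cast; ring)] at hneg
  have hcol : column a b e (v a b m + r * a N) =
      ((m : ℝ) ^ v a b m * a m * ((m : ℝ) + r) ^ (r * a N)) • e (v a b m + r * a N + 1) -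
      entryA a b m • f (1 + v a b m) := by
    simp only [column, lam, mu, src, hc, hneg, smul_smul, entryA]
    rw [add_comm 1 (v a b m)]
    congr 2
    push_cast; ring
  -- The index after the interval of A) lies in an interval of D) if `r = n`, and of B) otherwise.
  rcases Nat.eq_zero_or_pos m with rfl | hm
  · rw [v_zero] at hcol ⊢
    have hNr : N = r := by omega
    have hD : e (0 + r * a N + 1) = (weight N 0 (b N) (0 + r * a N + 1))⁻¹ •
        f (0 + r * a N + 1) := by
      have := h.na_lt N hn
      refine h.e_D he (by omega) ?_ ?_ <;> rw [hNr] at * <;> omega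
    rw [weight_inv_eq_decay (s := 1 + (N : ℝ) * a N) (by rw [hNr]; push_cast; ring)] at hD
    refine ⟨(N : ℝ) ^ (r * a N) * (((N : ℝ) ^ (r * a N + 1))⁻¹ * decay (1 + N * a N) (b N)),
      ?_, ?_, ?_⟩
    · have := decay_pos (1 + (N : ℝ) * a N) (b N : ℝ)
      positivity
    · have h1 := h.decay_b_le_one hn
      have h2 : (1 : ℝ) ≤ N := by exact_mod_cast hn
      rw [← mul_assoc, pow_succ, mul_inv, ← mul_assoc, mul_inv_cancel₀ (by positivity), one_mul]
      exact mul_le_one₀ (inv_le_one_of_one_le₀ h2) (decay_pos _ _).le h1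
    · rw [hcol, hD, smul_smul]
      simp [h.a_zero, hNr]
  · have hB : e (v a b m + r * a N + 1) = (weight N r (a N) (v a b m + r * a N + 1))⁻¹ •
        f (v a b m + r * a N + 1) := by
      have := h.v_add_one_lt_a (show m < N by omega)
      refine h.e_B he (by omega) ?_ ?_
      · rw [max_eq_left (by omega : 1 ≤ r), hN, Nat.add_sub_cancel]; omega
      · rw [add_mul, one_mul]; omega
    rw [weight_inv_eq_decay (s := 1 + v a b m) (by push_cast; ring)] at hB
    have hNpos : (0 : ℝ) < N := by exact_mod_cast hn
    have hNr : (m : ℝ) + r = N := by rw [hN]; push_cast; ring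
    refine ⟨(m : ℝ) ^ v a b m * a m * ((N : ℝ) ^ (r * a N)) *
      (((N : ℝ) ^ (v a b m + r * a N + 1))⁻¹ * decay (1 + v a b m) (a N)), ?_, ?_, ?_⟩
    · have := decay_pos (1 + v a b m) (a N : ℝ)
      positivity
    · have h1 := h.decay_a_le (show m < N by omega)
      have h2 : (m : ℝ) ^ v a b m * ((N : ℝ) ^ (v a b m + 1))⁻¹ ≤ 1 := by
        rw [mul_inv_le_iff₀ (by positivity), one_mul]
        calc (m : ℝ) ^ v a b m ≤ (N : ℝ) ^ v a b m := by gcongr; omega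
          _ ≤ _ := pow_le_pow_right₀ (by exact_mod_cast hn) (by omega)
      calc _ = ((m : ℝ) ^ v a b m * ((N : ℝ) ^ (v a b m + 1))⁻¹) *
            (a m * decay (1 + v a b m) (a N)) := by
            rw [show v a b m + r * a N + 1 = r * a N + (v a b m + 1) by ring, pow_add, mul_inv]
            field_simp
        _ ≤ 1 := mul_le_one₀ h2 (mul_nonneg (Nat.cast_nonneg _) (decay_pos _ _).le) h1
    · rw [hcol, hB, smul_smul, hNr]

/-- The columns at the right ends of the intervals of C): here the shift of `e_{i - bₙ}` lands at
the beginning of an interval of D) and produces a negative entry. -/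
theorem IsRapid.column_C_end (h : IsRapid a b) (he : IsReadSequence a b e) {r n : ℕ}
    (hr : 0 < r) (hrn : r ≤ n) :
    ∃ p : ℝ, 0 ≤ p ∧ p ≤ 1 ∧ column a b e (n * a n + r * b n) =
      p • f (n * a n + r * b n + 1) - entryC a b n • f (n * a n + (r - 1) * b n + 1) := by
  obtain ⟨q, rfl⟩ : ∃ q, r = q + 1 := ⟨r - 1, by omega⟩
  have hn : 1 ≤ n := by omega
  have hnpos : (0 : ℝ) < n := by exact_mod_cast hn
  have hn1 : (1 : ℝ) ≤ n := by exact_mod_cast hn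
  have ha := h.a_pos n
  have hb := h.na_lt n hn
  have hra : (q + 1) * a n ≤ n * a n := Nat.mul_le_mul_right _ hrn
  have hc := h.coeffs_C hr hrn (i := n * a n + (q + 1) * b n) (by linarith) le_rfl
  rw [show n * a n + (q + 1) * b n - b n = n * a n + q * b n by
    rw [add_mul, one_mul]; omega] at hc
  rw [Nat.add_sub_cancel]
  have hneg : e (n * a n + q * b n + 1) = (weight n q (b n) (n * a n + q * b n + 1))⁻¹ •
      f (n * a n + q * b n + 1) :=
    h.e_D he (by omega) (by omega) (by linarith [Nat.zero_le (q * a n)])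
  rw [weight_inv_eq_decay (s := 1 + (n : ℝ) * a n) (by push_cast; ring)] at hneg
  have hcol : column a b e (n * a n + (q + 1) * b n) =
      ((n : ℝ) ^ (n * a n + (q + 1) * b n)) • e (n * a n + (q + 1) * b n + 1) -
      entryC a b n • f (n * a n + q * b n + 1) := by
    simp only [column, lam, mu, src, hc, hneg, smul_smul, entryC]
    congr 2
    rw [pow_succ (n : ℝ) (n * a n + q * b n)]
    field_simp
  -- The index after the interval of C) lies in an interval of D) if `r < n`; for `r = n` it is
  -- `vₙ + 1`, which lies in the first interval of B) for `n + 1`.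
  rcases hrn.lt_or_eq with hlt | heq
  · have hD : e (n * a n + (q + 1) * b n + 1) =
        (weight n (q + 1) (b n) (n * a n + (q + 1) * b n + 1))⁻¹ •
          f (n * a n + (q + 1) * b n + 1) :=
      h.e_D he hlt (by omega) (by linarith [Nat.zero_le ((q + 1) * a n)])
    rw [weight_inv_eq_decay (s := 1 + (n : ℝ) * a n) (by push_cast; ring)] at hD
    refine ⟨(n : ℝ) ^ (n * a n + (q + 1) * b n) *
      (((n : ℝ) ^ (n * a n + (q + 1) * b n + 1))⁻¹ * decay (1 + n * a n) (b n)), ?_, ?_, ?_⟩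
    · have := decay_pos (1 + (n : ℝ) * a n) (b n : ℝ)
      positivity
    · rw [← mul_assoc, pow_succ, mul_inv, ← mul_assoc, mul_inv_cancel₀ (by positivity), one_mul]
      exact mul_le_one₀ (inv_le_one_of_one_le₀ hn1) (decay_pos _ _).le (h.decay_b_le_one hn)
    · rw [hcol, hD, smul_smul]
  · have hv : n * a n + (q + 1) * b n = v a b n := by rw [heq, v]; ring
    rw [hv] at hcol ⊢
    have hB : e (v a b n + 1) = (weight (n + 1) 0 (a (n + 1)) (v a b n + 1))⁻¹ •
        f (v a b n + 1) :=
      h.e_B he (by omega) (by simp) (by simpa using h.v_lt n)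
    rw [weight_inv_eq_decay (s := 1 + v a b n) (by push_cast; ring)] at hB
    refine ⟨(n : ℝ) ^ v a b n * ((((n + 1 : ℕ) : ℝ) ^ (v a b n + 1))⁻¹ *
      decay (1 + v a b n) (a (n + 1))), ?_, ?_, ?_⟩
    · have := decay_pos (1 + v a b n) (a (n + 1) : ℝ)
      positivity
    · have h1 := pow_ratio_le_one n (v a b n)
      rw [← mul_assoc, mul_comm ((n : ℝ) ^ _)]
      push_cast
      rw [add_comm (v a b n)]
      exact mul_le_one₀ h1 (decay_pos _ _).le (h.decay_a_le_one (by omega))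
    · rw [hcol, hB, smul_smul]

/-- The indices `s aₙ + j bₙ` run from the left end of an interval of A) to the left end of an
interval of C), in steps that the relation C) connects. Along them `nⁱ ‖eᵢ‖` grows by a factor
of at most `bₙ + 1` in each step. -/
theorem IsRapid.norm_e_le (h : IsRapid a b) (he : IsReadSequence a b e) {s n : ℕ}
    (hs : 0 < s) (hsn : s ≤ n) (j : ℕ) (hj : j ≤ s) :
    (n : ℝ) ^ (s * a n + j * b n) * ‖e (s * a n + j * b n)‖ ≤ 2 * ((b n : ℝ) + 1) ^ j := by
  have hn0 : (0 : ℝ) < n := by exact_mod_cast (by omega : 0 < n)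
  induction j with
  | zero =>
    simp only [zero_mul, add_zero, pow_zero, mul_one]
    have hA := he.relA s n (s * a n) hs hsn le_rfl (Nat.le_add_left _ _)
    rw [Nat.sub_self, pow_zero, one_mul, ← he.zero] at hA
    have ha : (1 : ℝ) ≤ a (n - s) := by exact_mod_cast h.a_pos _
    have hsol : (n : ℝ) ^ (s * a n) • e (s * a n) = (a (n - s) : ℝ)⁻¹ • f (s * a n) + f 0 := by
      rw [hA, smul_smul, inv_mul_cancel₀ (by positivity), one_smul, sub_add_cancel]
    have hnorm : ‖(n : ℝ) ^ (s * a n) • e (s * a n)‖ ≤ 1 + 1 := by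
      rw [hsol]
      refine (norm_add_le _ _).trans (add_le_add ?_ (norm_f 0).le)
      rw [norm_smul, norm_f, mul_one, norm_inv, Real.norm_of_nonneg (by positivity)]
      exact inv_le_one_of_one_le₀ ha
    rw [norm_smul, Real.norm_of_nonneg (by positivity)] at hnorm
    linarith
  | succ j ih =>
    have ih := ih (by omega)
    have h1 : (j + 1) * a n ≤ s * a n := Nat.mul_le_mul_right _ hj
    have h2 : s * a n ≤ n * a n := Nat.mul_le_mul_right _ hsn
    have hC := he.relC (j + 1) n (s * a n + (j + 1) * b n) (by omega) (by omega)
      (by linarith) (by linarith)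
    rw [show s * a n + (j + 1) * b n - b n = s * a n + j * b n by
      rw [add_mul, one_mul]; omega] at hC
    have hnorm : ‖(n : ℝ) ^ (s * a n + (j + 1) * b n) • e (s * a n + (j + 1) * b n)‖ ≤
        1 + b n * (2 * ((b n : ℝ) + 1) ^ j) := by
      rw [sub_eq_iff_eq_add.1 hC.symm]
      refine (norm_add_le _ _).trans (add_le_add (norm_f _).le ?_)
      rw [norm_smul, Real.norm_of_nonneg (by positivity), mul_assoc]
      gcongr
    rw [norm_smul, Real.norm_of_nonneg (by positivity)] at hnorm
    have h3 : (1 : ℝ) ≤ ((b n : ℝ) + 1) ^ j :=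
      one_le_pow₀ (by linarith [Nat.cast_nonneg (α := ℝ) (b n)])
    rw [pow_succ]
    linarith

theorem nonneg_and_norm_smul_f_le {c : ℝ} (h0 : 0 ≤ c) (h2 : c ≤ 2) (i : ℕ) :
    (∀ k, 0 ≤ (c • f i) k) ∧ ‖c • f i‖ ≤ 2 := by
  refine ⟨fun k => mul_nonneg h0 (f_apply_nonneg i k), ?_⟩
  rw [norm_smul, norm_f, mul_one, Real.norm_of_nonneg h0]
  exact h2

/-- The columns at the right ends of the intervals of B) and D), where `eᵢ₊₁` need not be a
multiple of `fᵢ₊₁`. -/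
theorem IsRapid.nonneg_and_norm_smul_e_le (h : IsRapid a b) (he : IsReadSequence a b e)
    {n i : ℕ} (hn : 1 ≤ n) {c M : ℝ} (h0 : 0 ≤ c)
    (hM : (n : ℝ) ^ (i + 1) * ‖e (i + 1)‖ ≤ 2 * M) (hc : M * c ≤ 1) :
    (∀ k, 0 ≤ (((n : ℝ) ^ i * c) • e (i + 1)) k) ∧ ‖((n : ℝ) ^ i * c) • e (i + 1)‖ ≤ 2 := by
  have hn1 : (1 : ℝ) ≤ n := by exact_mod_cast hn
  have hc0 : 0 ≤ (n : ℝ) ^ i * c := by positivity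
  refine ⟨fun k => mul_nonneg hc0 (h.e_nonneg he _ _), ?_⟩
  rw [norm_smul, Real.norm_of_nonneg hc0]
  calc (n : ℝ) ^ i * c * ‖e (i + 1)‖ ≤ (n : ℝ) ^ (i + 1) * c * ‖e (i + 1)‖ := by
        gcongr
        exact Nat.le_succ i
    _ = (n : ℝ) ^ (i + 1) * ‖e (i + 1)‖ * c := by ring
    _ ≤ 2 * M * c := by gcongr
    _ ≤ 2 := by linarith

/-- Every column is positive with norm at most `2`, except at the right ends of the intervals of A)
and C). -/
theorem IsRapid.column_cases (h : IsRapid a b) (he : IsReadSequence a b e) (i : ℕ) :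
    ((∀ k, 0 ≤ column a b e i k) ∧ ‖column a b e i‖ ≤ 2) ∨
      (∃ r n, 0 < r ∧ r ≤ n ∧ i = v a b (n - r) + r * a n) ∨
      (∃ r n, 0 < r ∧ r ≤ n ∧ i = n * a n + r * b n) := by
  rcases h.slot i with _ | ⟨r, n, _, hr, hrn, h1, h2⟩ | ⟨r, n, _, hrn, h1, h2⟩ |
      ⟨r, n, _, hr, hrn, h1, h2⟩ | ⟨r, n, _, hrn, h1, h2⟩
  · left
    have hv := h.v_lt 0
    rw [v_zero, zero_add] at hv
    have hB := h.e_B he (r := 0) (n := 1) (i := 1) one_pos (by simp [v_zero]) (by simpa using hv)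
    rw [weight_inv_eq_decay (s := 1) (by simp)] at hB
    have hcol : column a b e 0 = decay 1 (a 1) • f 1 := by
      simp [column, lam, mu, src, coeffs_zero, hB]
    rw [hcol]
    refine nonneg_and_norm_smul_f_le (decay_pos _ _).le ?_ 1
    have : (2 : ℝ) ≤ a 1 := by exact_mod_cast hv
    linarith [decay_le_one (show (1 : ℝ) ≤ a 1 / 2 by linarith)]
  · rcases h2.lt_or_eq with hlt | rfl
    · left
      have hrn' : r < n := by
        rcases hrn.lt_or_eq with hrn | rfl
        · exact hrn
        · rw [Nat.sub_self, v_zero] at hlt; omega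
      have hA := he.relA r n (i + 1) hr hrn (by omega) (by omega)
      rw [show i + 1 - r * a n = i - r * a n + 1 by omega, pow_succ] at hA
      have hd : (1 : ℝ) ≤ (n : ℝ) - r := by
        rw [le_sub_iff_add_le, add_comm]; exact_mod_cast hrn'
      have hcol : column a b e i = ((n : ℝ) - r)⁻¹ • f (i + 1) := by
        simp only [column, lam, mu, src, h.coeffs_A hr hrn h1 h2, hA, smul_smul, smul_sub]
        congr 2 <;> field_simp
      rw [hcol]
      exact nonneg_and_norm_smul_f_le (by positivity)
        ((inv_le_one_of_one_le₀ hd).trans one_le_two) _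
    · exact .inr (.inl ⟨r, n, hr, hrn, rfl⟩)
  · left
    have hn : 1 ≤ n := by omega
    have hcol : column a b e i = weight n r (a n) i • e (i + 1) := by
      simp [column, lam, mu, src, h.coeffs_B hrn h1 h2]
    rw [hcol]
    rcases (Nat.succ_le_of_lt h2).lt_or_eq with hlt | heq
    · rw [h.e_B he hrn (by omega) hlt, smul_smul]
      obtain ⟨h3, h4⟩ := weight_mul_inv_succ hn (h.a_pos n) r i
      exact nonneg_and_norm_smul_f_le h3 h4 _
    · have heq' : i + 1 = (r + 1) * a n := heq
      rw [weight_eq_decay (s := 1) (by rw [eq_sub_iff_add_eq]; exact_mod_cast heq')]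
      refine h.nonneg_and_norm_smul_e_le he hn (decay_pos _ _).le (M := 1) ?_ ?_
      · have := h.norm_e_le he (s := r + 1) (n := n) (by omega) hrn 0 (by omega)
        simpa [heq'] using this
      · rw [one_mul]
        have : (2 : ℝ) ≤ a n := by
          have := h.v_add_one_lt_a (show n - 1 < n by omega)
          exact_mod_cast (by omega : 2 ≤ a n)
        exact decay_le_one (by linarith)
  · rcases h2.lt_or_eq with hlt | rfl
    · left
      have hn : (1 : ℝ) ≤ n := by exact_mod_cast (by omega : 1 ≤ n)
      have hC := he.relC r n (i + 1) hr hrn (by omega) (by omega)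
      have hbi : b n ≤ i := by
        have : 1 * (a n + b n) ≤ r * (a n + b n) := Nat.mul_le_mul_right _ hr
        omega
      rw [show i + 1 - b n = i - b n + 1 by omega, pow_succ, pow_succ] at hC
      have hcol : column a b e i = (n : ℝ)⁻¹ • f (i + 1) := by
        simp only [column, lam, mu, src, h.coeffs_C hr hrn h1 h2, hC, smul_smul, smul_sub]
        congr 2 <;> field_simp
      rw [hcol]
      exact nonneg_and_norm_smul_f_le (by positivity)
        ((inv_le_one_of_one_le₀ hn).trans one_le_two) _
    · exact .inr (.inr ⟨r, n, hr, hrn, rfl⟩)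
  · left
    have hn : 1 ≤ n := by omega
    have hcol : column a b e i = weight n r (b n) i • e (i + 1) := by
      simp [column, lam, mu, src, h.coeffs_D hrn h1 h2]
    rw [hcol]
    rcases (Nat.succ_le_of_lt h2).lt_or_eq with hlt | heq
    · rw [h.e_D he hrn (by omega) hlt, smul_smul]
      obtain ⟨h3, h4⟩ := weight_mul_inv_succ hn (h.b_pos n hn) r i
      exact nonneg_and_norm_smul_f_le h3 h4 _
    · have heq' : i + 1 = (r + 1) * a n + (r + 1) * b n := by rw [← mul_add]; exact heq
      rw [weight_eq_decay (s := 1 - (r + 1) * a n) (by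
        have : (i : ℝ) + 1 = (r + 1) * a n + (r + 1) * b n := by exact_mod_cast heq'
        linarith)]
      refine h.nonneg_and_norm_smul_e_le he hn (decay_pos _ _).le
        (M := ((b n : ℝ) + 1) ^ (r + 1)) ?_ ?_
      · have := h.norm_e_le he (s := r + 1) (n := n) (by omega) hrn (r + 1) le_rfl
        rwa [← heq'] at this
      · refine le_trans ?_ (h.decay_b_pow n hn)
        have hd : decay (1 - ((r : ℝ) + 1) * a n) (b n) ≤ decay 1 (b n) :=
          decay_mono (sub_le_self _ (by positivity)) _
        have := decay_pos (1 - ((r : ℝ) + 1) * a n) (b n : ℝ)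
        gcongr
        · linarith [Nat.cast_nonneg (α := ℝ) (b n)]
        · exact hrn

end Columns

/-! ### Growth conditions -/

section Growth

open Filter Topology

/-- Exponential decay in `√x` beats every polynomial. A single constant `C` serves as factor,
exponent and shift, so that one threshold covers all growth conditions. -/
theorem exists_threshold (C : ℕ) :
    ∃ N : ℕ, ∀ x : ℕ, N ≤ x → C < x ∧ ((C : ℝ) * (x + 1)) ^ C * decay C x ≤ 1 := by
  -- In terms of `u = √x log 2 / 2`, the quantity is at most `(64 C) ^ C u ^ (2 C) exp (-u)`.
  have hlog : 0 < Real.log 2 := Real.log_pos one_lt_two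
  have hu : Tendsto (fun x : ℕ => √(x : ℝ) * (Real.log 2 / 2)) atTop atTop :=
    (Real.tendsto_sqrt_atTop.comp tendsto_natCast_atTop_atTop).atTop_mul_const (by positivity)
  have hlim := ((Real.tendsto_pow_mul_exp_neg_atTop_nhds_zero (2 * C)).comp hu).const_mul
    ((64 * (C : ℝ)) ^ C)
  rw [mul_zero] at hlim
  have hev := (hlim.eventually_le_const one_pos).and (eventually_gt_atTop C)
  obtain ⟨N, hN⟩ := eventually_atTop.1 hev
  refine ⟨N, fun x hx => ⟨(hN x hx).2, le_trans ?_ (hN x hx).1⟩⟩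
  have hCx := (hN x hx).2
  have hx1 : (1 : ℝ) ≤ x := by exact_mod_cast (by omega : 1 ≤ x)
  simp only [Function.comp_apply]
  set y := √(x : ℝ) with hy
  have hy1 : 1 ≤ y := by rw [hy, Real.one_le_sqrt]; exact hx1
  have hyx : y * y = x := Real.mul_self_sqrt (by linarith)
  set u := y * (Real.log 2 / 2) with hu_def
  have huy : y ≤ 4 * u := by
    have : (1 : ℝ) / 2 ≤ Real.log 2 := by linarith [Real.log_two_gt_d9]
    rw [hu_def]; nlinarith
  have hdec : decay C x ≤ 2 ^ C * Real.exp (-u) := by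
    have h1 : decay C x ≤ (2 : ℝ) ^ ((C : ℝ) + -(y / 2)) := by
      unfold decay
      rw [← hy]
      refine Real.rpow_le_rpow_of_exponent_le one_le_two ?_
      rw [div_le_iff₀ (by linarith), ← hyx]
      nlinarith [Nat.cast_nonneg (α := ℝ) C]
    refine h1.trans_eq ?_
    rw [Real.rpow_add two_pos, Real.rpow_natCast, Real.rpow_def_of_pos two_pos]
    congr 2
    rw [hu_def]; ring
  have hx2 : (x : ℝ) + 1 ≤ 32 * u ^ 2 := by nlinarith
  calc ((C : ℝ) * (x + 1)) ^ C * decay C x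
      ≤ ((C : ℝ) * (32 * u ^ 2)) ^ C * (2 ^ C * Real.exp (-u)) := by
        gcongr
        exact (decay_pos _ _).le
    _ = (64 * (C : ℝ)) ^ C * (u ^ (2 * C) * Real.exp (-u)) := by
        rw [show (64 * (C : ℝ)) = 2 * (C * 32) by ring, pow_mul, mul_pow 2, ← mul_assoc (C : ℝ),
          mul_pow _ (u ^ 2)]
        ring

/-- A number beyond which every `x` dominates the constant `C` in the sense of
`exists_threshold`. -/
noncomputable def threshold (C : ℕ) : ℕ := (exists_threshold C).choose

theorem threshold_spec {C x : ℕ} (h : threshold C ≤ x) :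
    C < x ∧ ((C : ℝ) * (x + 1)) ^ C * decay C x ≤ 1 :=
  (exists_threshold C).choose_spec x h

theorem mul_decay_le_one {C x : ℕ} (h : threshold C ≤ x) {K s : ℝ}
    (hK : K ≤ ((C : ℝ) * (x + 1)) ^ C) (hs : s ≤ C) : K * decay s x ≤ 1 := by
  refine le_trans ?_ (threshold_spec h).2
  have := decay_pos s x
  have := decay_mono hs x
  gcongr

/-- The growth function for `aₙ`; it depends on `aₙ₋₁` and `bₙ₋₁` only. -/
noncomputable def growthA : (n : ℕ) → (Fin n → ℕ) → (Fin n → ℕ) → ℕ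
  | 0, _, _ => 0
  | n + 1, α, β =>
    threshold (α (Fin.last n) * (n * (α (Fin.last n) + β (Fin.last n)) + 3) ^ 2)

/-- The growth function for `bₙ`; it depends on `aₙ` only. -/
noncomputable def growthB (n : ℕ) (_ _ : Fin n → ℕ) (x : ℕ) : ℕ := threshold (n * x + n + 3)

theorem isRapid_of_grows {a b : ℕ → ℕ} (hd : IsData a b) (hg : Grows growthA growthB a b) :
    IsRapid a b := by
  have ha0 : ∀ n, 1 ≤ a n := fun n => by
    rcases Nat.eq_zero_or_pos n with rfl | hn
    · exact hd.a_zero.ge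
    · obtain ⟨m, rfl⟩ : ∃ m, n = m + 1 := ⟨n - 1, by omega⟩
      rcases Nat.eq_zero_or_pos m with rfl | hm
      · exact hd.a_one_pos
      · have := hd.b_lt_a m hm; omega
  have hA : ∀ n, threshold (a n * (v a b n + 3) ^ 2) ≤ a (n + 1) := fun n =>
    (hg (n + 1) (by omega)).1
  have hB : ∀ n, 1 ≤ n → threshold (n * a n + n + 3) ≤ b n := fun n hn => (hg n hn).2
  have hC : ∀ n, v a b n + 3 ≤ a n * (v a b n + 3) ^ 2 := fun n => by
    nlinarith [Nat.mul_le_mul_right ((v a b n + 3) ^ 2) (ha0 n)]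
  have hone : ∀ n, (1 : ℝ) ≤ ((n * a n + n + 3 : ℕ) : ℝ) * ((b n : ℝ) + 1) := fun n => by
    exact_mod_cast Nat.mul_pos (by omega) (by omega)
  refine { hd with v_lt := fun n => ?_, na_lt := fun n hn => ?_, decay_a := fun n => ?_,
                   decay_b := fun n hn => ?_, decay_b_pow := fun n hn => ?_ }
  · have := (threshold_spec (hA n)).1
    have := hC n
    omega
  · have := (threshold_spec (hB n hn)).1
    omega
  · refine mul_decay_le_one (hA n) ?_ ?_
    · have h1 : (a n * (v a b n + 3) ^ 2) ≤
          (a n * (v a b n + 3) ^ 2 * (a (n + 1) + 1)) ^ (a n * (v a b n + 3) ^ 2) := by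
        refine (Nat.le_mul_of_pos_right _ (Nat.succ_pos _)).trans
          (Nat.le_self_pow (by have := hC n; omega) _)
      exact_mod_cast h1
    · have := hC n
      exact_mod_cast (by omega : 1 + v a b n ≤ a n * (v a b n + 3) ^ 2)
  · refine mul_decay_le_one (hB n hn) ?_ ?_
    · refine le_trans ?_ (pow_le_pow_right₀ (hone n) (show 3 ≤ n * a n + n + 3 by omega))
      have h1 : b n ≤ (n * a n + n + 3) * (b n + 1) :=
        (Nat.le_succ _).trans (Nat.le_mul_of_pos_left _ (by omega))
      have h2 : v a b n + 2 ≤ (n * a n + n + 3) * (b n + 1) := by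
        have : (n * a n + n + 3) * (b n + 1) =
          n * (a n + b n) + 2 + (n * a n * b n + 3 * b n + n + 1) := by ring
        unfold v; omega
      have h3 : b n * (v a b n + 2) ^ 2 ≤ ((n * a n + n + 3) * (b n + 1)) ^ 3 := by
        rw [show ((n * a n + n + 3) * (b n + 1)) ^ 3 = ((n * a n + n + 3) * (b n + 1)) *
          ((n * a n + n + 3) * (b n + 1)) ^ 2 by ring]
        exact Nat.mul_le_mul h1 (Nat.pow_le_pow_left h2 2)
      exact_mod_cast h3
    · exact_mod_cast (by omega : 1 + n * a n ≤ n * a n + n + 3)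
  · refine mul_decay_le_one (hB n hn) ?_ ?_
    · refine le_trans ?_ (pow_le_pow_right₀ (hone n) (show n ≤ n * a n + n + 3 by omega))
      have h1 : (b n + 1) ^ n ≤ ((n * a n + n + 3) * (b n + 1)) ^ n :=
        Nat.pow_le_pow_left (Nat.le_mul_of_pos_left _ (by omega)) n
      exact_mod_cast h1
    · exact_mod_cast (by omega : 1 ≤ n * a n + n + 3)

end Growth

/-! ### The operator and its negative part -/

section Operator

variable {a b : ℕ → ℕ} {e : ℕ → Ell1}

theorem IsRapid.norm_column_le (h : IsRapid a b) (he : IsReadSequence a b e) (i : ℕ) :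
    ‖column a b e i‖ ≤ 2 := by
  have key : ∀ {p c : ℝ} {k l : ℕ}, 0 ≤ p → p ≤ 1 → 0 ≤ c → c ≤ 1 →
      ‖p • f k - c • f l‖ ≤ 2 := fun {p c k l} h0 h1 h2 h3 => by
    refine (norm_sub_le _ _).trans ?_
    rw [norm_smul, norm_smul, norm_f, norm_f, Real.norm_of_nonneg h0, Real.norm_of_nonneg h2]
    linarith
  have hle : ∀ k : ℕ, 1 / (((k : ℝ) + 1) * ((k : ℝ) + 2)) ≤ 1 := fun k => by
    have : (0 : ℝ) ≤ k := Nat.cast_nonneg _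
    rw [div_le_one (by positivity)]; nlinarith
  rcases h.column_cases he i with h1 | ⟨r, n, hr, hrn, rfl⟩ | ⟨r, n, hr, hrn, rfl⟩
  · exact h1.2
  · obtain ⟨p, hp0, hp1, hcol⟩ := h.column_A_end he hr hrn
    rw [hcol]
    exact key hp0 hp1 (entryA_nonneg _) ((h.entryA_le _).trans (hle _))
  · obtain ⟨p, hp0, hp1, hcol⟩ := h.column_C_end he hr hrn
    rw [hcol]
    exact key hp0 hp1 (entryC_nonneg _)
      ((h.entryC_le (k := 0) (by omega) (Nat.zero_le _)).trans (hle _))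

theorem IsRapid.existsUnique_isReadOperator (h : IsRapid a b) :
    ∃! T : Ell1 →L[ℝ] Ell1, IsReadOperator a b T := by
  obtain ⟨e, he⟩ := h.exists_isReadSequence
  obtain ⟨T, hT⟩ := exists_clm_of_columns _ (h.norm_column_le he)
  refine ⟨T, ⟨e, he, h.apply_e he hT⟩, ?_⟩
  rintro T' ⟨e', he', hT'⟩
  obtain rfl := h.readSequence_unique he he'
  exact clm_ext fun j => by rw [hT j, h.apply_f he hT' j]

/-- The entrywise negative part of a column `p fᵢ - c fₗ` is `c fₗ`. -/
theorem max_neg_column {p c : ℝ} (hp : 0 ≤ p) (hc : 0 ≤ c) {i l : ℕ} (hil : l ≠ i) (k : ℕ) :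
    max (-(p • f i - c • f l) k) 0 = if k = l then c else 0 := by
  have : (p • f i - c • f l) k = p * f i k - c * f l k := rfl
  rw [this, f_apply, f_apply]
  by_cases hk : k = l
  · subst hk
    simp [hil, hc]
  · simp only [hk, if_false]
    split_ifs <;> simp [hp]

variable {T S : Ell1 →L[ℝ] Ell1}

theorem IsRapid.max_neg_entry_A (h : IsRapid a b) (hT : IsReadOperator a b T) {r n : ℕ}
    (hr : 0 < r) (hrn : r ≤ n) (k : ℕ) :
    max (-entry T k (v a b (n - r) + r * a n)) 0 =
      if k = 1 + v a b (n - r) then entryA a b (n - r) else 0 := by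
  obtain ⟨e, he, hT⟩ := hT
  obtain ⟨p, hp, -, hcol⟩ := h.column_A_end he hr hrn
  have hpos : 0 < r * a n := Nat.mul_pos hr (h.a_pos n)
  rw [entry, h.apply_f he hT, hcol, max_neg_column hp (entryA_nonneg _) (by omega)]

theorem IsRapid.max_neg_entry_C (h : IsRapid a b) (hT : IsReadOperator a b T) {r n : ℕ}
    (hr : 0 < r) (hrn : r ≤ n) (k : ℕ) :
    max (-entry T k (n * a n + r * b n)) 0 =
      if k = n * a n + (r - 1) * b n + 1 then entryC a b n else 0 := by
  obtain ⟨e, he, hT⟩ := hT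
  obtain ⟨p, hp, -, hcol⟩ := h.column_C_end he hr hrn
  have hb := h.b_pos n (by omega)
  have hlt : (r - 1) * b n < r * b n := Nat.mul_lt_mul_of_pos_right (by omega) hb
  rw [entry, h.apply_f he hT, hcol, max_neg_column hp (entryC_nonneg _) (by omega)]

/-- The positions of the nonzero entries of the negative part. -/
theorem IsRapid.max_neg_entry_cases (h : IsRapid a b) (hT : IsReadOperator a b T) (k j : ℕ) :
    max (-entry T k j) 0 = 0 ∨ ∃ r n, 0 < r ∧ r ≤ n ∧
      ((k = 1 + v a b (n - r) ∧ j = v a b (n - r) + r * a n) ∨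
        (k = n * a n + (r - 1) * b n + 1 ∧ j = n * a n + r * b n)) := by
  have ⟨e, he, hTe⟩ := hT
  rcases h.column_cases he j with ⟨h1, -⟩ | ⟨r, n, hr, hrn, rfl⟩ | ⟨r, n, hr, hrn, rfl⟩
  · left
    rw [entry, h.apply_f he hTe]
    exact max_eq_right (neg_nonpos.2 (h1 k))
  · rw [h.max_neg_entry_A hT hr hrn]
    split_ifs with hk
    · exact .inr ⟨r, n, hr, hrn, .inl ⟨hk, rfl⟩⟩
    · exact .inl rfl
  · rw [h.max_neg_entry_C hT hr hrn]
    split_ifs with hk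
    · exact .inr ⟨r, n, hr, hrn, .inr ⟨hk, rfl⟩⟩
    · exact .inl rfl

/-- The bound compares with a telescoping series, so no counting of rows is needed. -/
theorem IsRapid.rowNorm_le (h : IsRapid a b) (hT : IsReadOperator a b T)
    (hS : ∀ k j, entry S k j = max (-entry T k j) 0) (k : ℕ) :
    rowNorm S k ≤ 1 / (((k : ℝ) + 1) * ((k : ℝ) + 2)) := by
  refine ciSup_le fun j => ?_
  rw [hS, abs_of_nonneg (le_max_right _ _)]
  rcases h.max_neg_entry_cases hT k j with h0 | ⟨r, n, hr, hrn, ⟨hk, rfl⟩ | ⟨hk, rfl⟩⟩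
  · rw [h0]; positivity
  · rw [h.max_neg_entry_A hT hr hrn, if_pos hk, hk]
    exact h.entryA_le _
  · rw [h.max_neg_entry_C hT hr hrn, if_pos hk]
    refine h.entryC_le (by omega) ?_
    have hb := h.b_pos n (by omega)
    have h1 : (r - 1) * b n < r * b n := Nat.mul_lt_mul_of_pos_right (by omega) hb
    have h2 : r * b n ≤ n * b n := Nat.mul_le_mul_right _ hrn
    rw [hk, v, mul_add]
    omega

theorem sum_telescope (N : ℕ) :
    ∑ k ∈ Finset.range N, 1 / (((k : ℝ) + 1) * ((k : ℝ) + 2)) = 1 - 1 / ((N : ℝ) + 1) := by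
  induction N with
  | zero => simp
  | succ N ih =>
    rw [Finset.sum_range_succ, ih]
    push_cast
    field_simp
    ring

theorem summable_and_tsum_lt_two {u : ℕ → ℝ} (h0 : ∀ k, 0 ≤ u k)
    (h1 : ∀ k, u k ≤ 1 / (((k : ℝ) + 1) * ((k : ℝ) + 2))) : Summable u ∧ ∑' k, u k < 2 := by
  have hle : ∀ N, ∑ k ∈ Finset.range N, u k ≤ 1 := fun N => by
    refine (Finset.sum_le_sum fun k _ => h1 k).trans ?_
    rw [sum_telescope]
    have : (0 : ℝ) ≤ 1 / ((N : ℝ) + 1) := by positivity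
    linarith
  exact ⟨summable_of_sum_range_le h0 hle,
    (Real.tsum_le_of_sum_range_le h0 hle).trans_lt one_lt_two⟩

end Operator

end Read

theorem mainTheorem3 :
    ∃ (G : (n : ℕ) → (Fin n → ℕ) → (Fin n → ℕ) → ℕ)
      (H : (n : ℕ) → (Fin n → ℕ) → (Fin n → ℕ) → ℕ → ℕ),
      ∀ a b : ℕ → ℕ, Read.IsData a b → Read.Grows G H a b →
        (∃! e : ℕ → Read.Ell1, Read.IsReadSequence a b e) ∧
        (∃! T : Read.Ell1 →L[ℝ] Read.Ell1, Read.IsReadOperator a b T) ∧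
        ∀ T : Read.Ell1 →L[ℝ] Read.Ell1, Read.IsReadOperator a b T →
          ∃ S : Read.Ell1 →L[ℝ] Read.Ell1, Read.IsNegativePart T S ∧
            Read.IsNuclear S ∧ IsCompactOperator S ∧
            -- the only nonzero entries of the matrix of `S`
            (∀ r n : ℕ, 0 < r → r ≤ n →
              Read.entry S (1 + Read.v a b (n - r)) (Read.v a b (n - r) + r * a n) =
                (((n : ℝ) - r + 1) ^ (1 + Read.v a b (n - r)))⁻¹ *
                  (2 : ℝ) ^ ((1 + (Read.v a b (n - r) : ℝ) - (a (n - r + 1) : ℝ) / 2) /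
                    √(a (n - r + 1) : ℝ)) *
                  (a (n - r) : ℝ) * ((n : ℝ) - r) ^ Read.v a b (n - r)) ∧
            (∀ r n : ℕ, 0 < r → r ≤ n →
              Read.entry S (n * a n + (r - 1) * b n + 1) (n * a n + r * b n) =
                (b n : ℝ) * (n : ℝ)⁻¹ *
                  (2 : ℝ) ^ ((1 + (n : ℝ) * (a n : ℝ) - (b n : ℝ) / 2) / √(b n : ℝ))) ∧
            (∀ k j : ℕ, Read.entry S k j ≠ 0 → ∃ r n : ℕ, 0 < r ∧ r ≤ n ∧
              ((k = 1 + Read.v a b (n - r) ∧ j = Read.v a b (n - r) + r * a n) ∨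
                (k = n * a n + (r - 1) * b n + 1 ∧ j = n * a n + r * b n))) ∧
            -- the sup-norms of the rows of the matrix of `S` have sum below 2
            Summable (Read.rowNorm S) ∧
            Read.nuclearNorm S ≤ ∑' k, Read.rowNorm S k ∧
            ∑' k, Read.rowNorm S k < 2 := by
  refine ⟨Read.growthA, Read.growthB, fun a b hd hg => ?_⟩
  have h := Read.isRapid_of_grows hd hg
  refine ⟨?_, h.existsUnique_isReadOperator, fun T hT => ?_⟩
  · obtain ⟨e, he⟩ := h.exists_isReadSequence
    exact ⟨e, he, fun e' he' => h.readSequence_unique he' he⟩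
  obtain ⟨S, hneg, hS⟩ := Read.exists_isNegativePart T
  obtain ⟨hsum, hlt⟩ := Read.summable_and_tsum_lt_two (Read.rowNorm_nonneg S) (h.rowNorm_le hT hS)
  have hnuc : Read.IsNuclear S := ⟨_, _, Read.isNuclearRep_rows hsum⟩
  refine ⟨S, hneg, hnuc, hnuc.isCompactOperator, fun r n hr hrn => ?_, fun r n hr hrn => ?_,
    fun k j hkj => ?_, hsum, Read.nuclearNorm_le_tsum_rowNorm hsum, hlt⟩
  · rw [hS, h.max_neg_entry_A hT hr hrn, if_pos rfl, Read.entryA, Nat.cast_sub hrn]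
    rfl
  · rw [hS, h.max_neg_entry_C hT hr hrn, if_pos rfl]
    rfl
  · rw [hS] at hkj
    exact (h.max_neg_entry_cases hT k j).resolve_left hkj
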